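/- Let $\beta\in(0,1)$, $d\in\{1,2,3\}$ and let $k\ge 1$ be an integer. Let $D=(D_t)_{t\ge 0}$ be a $\beta$-stable subordinator on a probability space, i.e. a process with $D_0=0$ a.s., with independent and stationary increments, with a.s. nondecreasing right-continuous paths, and normalized by $\mathbb{E}(e^{-sD_t})=e^{-ts^\beta}$ for all $s,t\ge 0$. Then $D_1>0$ a.s., the random variable $D_1^{-\beta(k-d/4)}$ is integrable, and its expectation $$a_k^d(\beta):=\mathbb{E}\big(D_1^{-\beta(k-\frac d4)}\big)=\int_0^\infty w^{-\beta(k-\frac d4)}g_\beta(w)\,dw,$$ where $g_\beta$ is any (nonnegative, measurable) Lebesgue density of $D_1$, satisfies $$0<a_k^d(\beta)\le 3\,\frac{\Gamma(1+k)}{\Gamma(1+\beta k)} .$$ -/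

import Mathlib

open MeasureTheory ProbabilityTheory
open scoped NNReal ENNReal

/-- `D = (D_t)_{t ≥ 0}` is a `β`-stable subordinator on `(Ω, μ)`: a process started at `0` with
independent and stationary increments, whose paths are a.s. nondecreasing and right-continuous
(left limits then exist by monotonicity), normalized so that its Laplace exponent is `s ↦ s ^ β`,
that is `E[exp (-s D_t)] = exp (-t s ^ β)`. -/
structure IsStableSubordinator {Ω : Type*} [MeasurableSpace Ω] (β : ℝ) (D : ℝ≥0 → Ω → ℝ)
    (μ : Measure Ω) : Prop where
  measurable : ∀ t, Measurable (D t)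
  start_zero : ∀ᵐ ω ∂μ, D 0 ω = 0
  indep_increments : HasIndepIncrements D μ
  stationary_increments : ∀ s t : ℝ≥0, IdentDistrib (fun ω => D (s + t) ω - D s ω) (D t) μ μ
  monotone_paths : ∀ᵐ ω ∂μ, Monotone fun t => D t ω
  rightContinuous_paths :
    ∀ᵐ ω ∂μ, ∀ t : ℝ≥0, ContinuousWithinAt (fun u => D u ω) (Set.Ici t) t
  laplace : ∀ (t : ℝ≥0) (s : ℝ), 0 ≤ s →
    ∫ ω, Real.exp (-(s * D t ω)) ∂μ = Real.exp (-((t : ℝ) * s ^ β))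

/-- `g` is a (nonnegative, measurable) Lebesgue density of the law of the real random
variable `X`. -/
structure IsLebesgueDensity {Ω : Type*} [MeasurableSpace Ω] (X : Ω → ℝ) (μ : Measure Ω)
    (g : ℝ → ℝ) : Prop where
  measurable : Measurable g
  nonneg : ∀ w, 0 ≤ g w
  map_eq : μ.map X = volume.withDensity fun w => ENNReal.ofReal (g w)

/-- The random variable `D_1 ^ (-β (k - d / 4))`. -/
noncomputable def stablePower {Ω : Type*} (β : ℝ) (D : ℝ≥0 → Ω → ℝ) (d k : ℕ) (ω : Ω) : ℝ :=
  D 1 ω ^ (-(β * ((k : ℝ) - (d : ℝ) / 4)))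

/-- The moment `a_k^d(β) = E[D_1 ^ (-β (k - d / 4))]`. -/
noncomputable def stableMoment {Ω : Type*} [MeasurableSpace Ω] (β : ℝ) (D : ℝ≥0 → Ω → ℝ)
    (μ : Measure Ω) (d k : ℕ) : ℝ :=
  ∫ ω, stablePower β D d k ω ∂μ

/-! Only the law of X = D_1 matters. Integrating s^(βx-1) E[e^(-sX)] = s^(βx-1) e^(-s^β) over s > 0
and applying Tonelli gives Γ(βx) E[X^(-βx)] = Γ(x)/β, so E[X^(-βx)] = Γ(1+x)/Γ(1+βx) for every x > 0
(`lintegral_rpow_neg_of_laplace_eq_exp_neg_rpow`). Positivity and integrability follow with x = k -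
d/4. For the bound, weighted AM-GM compares this moment with the one at x = k, whose value M is at
least 1 by convexity of Γ; this gives even the constant 1. -/

/-- If a.s. nonnegative `X` has Laplace transform `exp (-s ^ β)`, then it is a.s. positive. -/
theorem ae_pos_of_laplace_eq_exp_neg_rpow {Ω : Type*} [MeasurableSpace Ω] {μ : Measure Ω}
    [IsProbabilityMeasure μ] {β : ℝ} (hβ : 0 < β) {X : Ω → ℝ} (hX : Measurable X)
    (hX0 : ∀ᵐ ω ∂μ, 0 ≤ X ω)
    (hL : ∀ s : ℝ, 0 ≤ s → ∫ ω, Real.exp (-(s * X ω)) ∂μ = Real.exp (-(s ^ β))) :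
    ∀ᵐ ω ∂μ, 0 < X ω := by
  have hA : MeasurableSet {ω | X ω ≤ 0} := measurableSet_le hX measurable_const
  have hle : ∀ s : ℝ, 0 ≤ s → μ.real {ω | X ω ≤ 0} ≤ Real.exp (-(s ^ β)) := by
    intro s hs
    have hint : Integrable (fun ω => Real.exp (-(s * X ω))) μ := by
      refine Integrable.of_bound (by fun_prop) 1 ?_
      filter_upwards [hX0] with ω hω
      rw [Real.norm_eq_abs, Real.abs_exp, Real.exp_le_one_iff]
      have := mul_nonneg hs hω
      linarith
    -- Markov-type bound: exp(-sX) ≥ 1 wherever X ≤ 0.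
    rw [← hL s hs, ← integral_indicator_one hA]
    refine integral_mono_ae ((integrable_const (1 : ℝ)).indicator hA) hint ?_
    refine Filter.Eventually.of_forall fun ω => ?_
    by_cases h : X ω ≤ 0
    · have h' : s * X ω ≤ 0 := mul_nonpos_of_nonneg_of_nonpos hs h
      simp [Set.indicator, h, h']
    · simp [Set.indicator, h, (Real.exp_pos _).le]
  have hlim : Filter.Tendsto (fun s : ℝ => Real.exp (-(s ^ β))) Filter.atTop (nhds 0) :=
    Real.tendsto_exp_neg_atTop_nhds_zero.comp (tendsto_rpow_atTop hβ)
  have h0 : μ.real {ω | X ω ≤ 0} ≤ 0 := by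
    refine ge_of_tendsto hlim ?_
    filter_upwards [Filter.eventually_ge_atTop (0 : ℝ)] with s hs using hle s hs
  have h1 : μ {ω | X ω ≤ 0} = 0 :=
    (measureReal_eq_zero_iff).1 (le_antisymm h0 measureReal_nonneg)
  rw [ae_iff]
  simpa only [not_lt] using h1

theorem lintegral_rpow_mul_exp_neg_mul_Ioi {r x : ℝ} (hr : 0 < r) (hx : 0 < x) :
    ∫⁻ s in Set.Ioi (0 : ℝ), ENNReal.ofReal (s ^ (r - 1) * Real.exp (-(s * x))) =
      ENNReal.ofReal (Real.Gamma r) * ENNReal.ofReal (x ^ (-r)) := by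
  have h := Real.integral_rpow_mul_exp_neg_mul_Ioi hr hx
  have hpos : 0 < (1 / x) ^ r * Real.Gamma r :=
    mul_pos (Real.rpow_pos_of_pos (by positivity) _) (Real.Gamma_pos_of_pos hr)
  have hint : Integrable (fun t : ℝ => t ^ (r - 1) * Real.exp (-(x * t)))
      (volume.restrict (Set.Ioi 0)) := by
    -- A non-integrable function has integral 0 by convention, but the Gamma value is positive.
    by_contra hn
    rw [integral_undef hn] at h
    exact hpos.ne h
  have h2 := ofReal_integral_eq_lintegral_ofReal hint (by
    filter_upwards [ae_restrict_mem measurableSet_Ioi] with t ht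
    exact mul_nonneg (Real.rpow_nonneg (le_of_lt ht) _) (Real.exp_pos _).le)
  simp_rw [mul_comm _ x]
  rw [← h2, h, ← ENNReal.ofReal_mul (Real.Gamma_pos_of_pos hr).le, mul_comm, one_div,
    Real.inv_rpow hx.le, Real.rpow_neg hx.le]

theorem lintegral_rpow_mul_exp_neg_rpow_Ioi {r β : ℝ} (hr : 0 < r) (hβ : 0 < β) :
    ∫⁻ s in Set.Ioi (0 : ℝ), ENNReal.ofReal (s ^ (r - 1) * Real.exp (-(s ^ β))) =
      ENNReal.ofReal (1 / β * Real.Gamma (r / β)) := by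
  have h := integral_rpow_mul_exp_neg_rpow hβ (q := r - 1) (by linarith)
  rw [sub_add_cancel] at h
  have hpos : 0 < 1 / β * Real.Gamma (r / β) :=
    mul_pos (by positivity) (Real.Gamma_pos_of_pos (by positivity))
  have hint : Integrable (fun t : ℝ => t ^ (r - 1) * Real.exp (-(t ^ β)))
      (volume.restrict (Set.Ioi 0)) := by
    by_contra hn
    rw [integral_undef hn] at h
    exact hpos.ne h
  rw [← h, ofReal_integral_eq_lintegral_ofReal hint]
  filter_upwards [ae_restrict_mem measurableSet_Ioi] with t ht
  exact mul_nonneg (Real.rpow_nonneg (le_of_lt ht) _) (Real.exp_pos _).le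

/-- Negative moments of the one-sided stable law. -/
theorem lintegral_rpow_neg_of_laplace_eq_exp_neg_rpow {Ω : Type*} [MeasurableSpace Ω]
    {μ : Measure Ω} [IsProbabilityMeasure μ] {β : ℝ} (hβ : 0 < β) {X : Ω → ℝ}
    (hX : Measurable X) (hX0 : ∀ᵐ ω ∂μ, 0 < X ω)
    (hL : ∀ s : ℝ, 0 ≤ s → ∫ ω, Real.exp (-(s * X ω)) ∂μ = Real.exp (-(s ^ β)))
    {x : ℝ} (hx : 0 < x) :
    ∫⁻ ω, ENNReal.ofReal (X ω ^ (-(β * x))) ∂μ =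
      ENNReal.ofReal (Real.Gamma (1 + x) / Real.Gamma (1 + β * x)) := by
  have hr : 0 < β * x := mul_pos hβ hx
  have hΓ : 0 < Real.Gamma (β * x) := Real.Gamma_pos_of_pos hr
  have key : ENNReal.ofReal (Real.Gamma (β * x)) *
      ∫⁻ ω, ENNReal.ofReal (X ω ^ (-(β * x))) ∂μ = ENNReal.ofReal (1 / β * Real.Gamma x) := by
    calc ENNReal.ofReal (Real.Gamma (β * x)) * ∫⁻ ω, ENNReal.ofReal (X ω ^ (-(β * x))) ∂μ
        = ∫⁻ ω, ENNReal.ofReal (Real.Gamma (β * x)) *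
            ENNReal.ofReal (X ω ^ (-(β * x))) ∂μ :=
          (lintegral_const_mul _ (by fun_prop)).symm
      _ = ∫⁻ ω, (∫⁻ s in Set.Ioi (0 : ℝ),
            ENNReal.ofReal (s ^ (β * x - 1) * Real.exp (-(s * X ω)))) ∂μ := by
          refine lintegral_congr_ae ?_
          filter_upwards [hX0] with ω hω
          exact (lintegral_rpow_mul_exp_neg_mul_Ioi hr hω).symm
      _ = ∫⁻ s in Set.Ioi (0 : ℝ), ∫⁻ ω,
            ENNReal.ofReal (s ^ (β * x - 1) * Real.exp (-(s * X ω))) ∂μ := by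
          refine lintegral_lintegral_swap (Measurable.aemeasurable ?_)
          simp only [Function.uncurry_def]
          fun_prop
      _ = ∫⁻ s in Set.Ioi (0 : ℝ),
            ENNReal.ofReal (s ^ (β * x - 1) * Real.exp (-(s ^ β))) := by
          refine setLIntegral_congr_fun measurableSet_Ioi fun s hs => ?_
          have hs0 : 0 ≤ s := le_of_lt hs
          have hint : Integrable (fun ω => Real.exp (-(s * X ω))) μ := by
            refine Integrable.of_bound (by fun_prop) 1 ?_
            filter_upwards [hX0] with ω hω
            rw [Real.norm_eq_abs, Real.abs_exp, Real.exp_le_one_iff]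
            have := mul_nonneg hs0 hω.le
            linarith
          simp_rw [ENNReal.ofReal_mul (Real.rpow_nonneg hs0 (β * x - 1))]
          rw [lintegral_const_mul _ (by fun_prop), ← hL s hs0,
            ofReal_integral_eq_lintegral_ofReal hint
              (Filter.Eventually.of_forall fun ω => (Real.exp_pos _).le)]
      _ = ENNReal.ofReal (1 / β * Real.Gamma x) := by
          rw [lintegral_rpow_mul_exp_neg_rpow_Ioi hr hβ, mul_div_cancel_left₀ _ hβ.ne']
  have hval : Real.Gamma (β * x) * (Real.Gamma (1 + x) / Real.Gamma (1 + β * x)) =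
      1 / β * Real.Gamma x := by
    rw [add_comm 1 x, add_comm 1 (β * x), Real.Gamma_add_one hx.ne', Real.Gamma_add_one hr.ne']
    field_simp
  rw [← hval, ENNReal.ofReal_mul hΓ.le] at key
  exact (ENNReal.mul_right_inj (by simpa using hΓ) ENNReal.ofReal_ne_top).1 key

theorem integrable_and_integral_eq_of_lintegral_ofReal_eq {Ω : Type*} [MeasurableSpace Ω]
    {μ : Measure Ω} {f : Ω → ℝ} {c : ℝ} (hf : AEStronglyMeasurable f μ) (hf0 : 0 ≤ᵐ[μ] f)
    (hc : 0 ≤ c) (h : ∫⁻ ω, ENNReal.ofReal (f ω) ∂μ = ENNReal.ofReal c) :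
    Integrable f μ ∧ ∫ ω, f ω ∂μ = c := by
  refine ⟨(lintegral_ofReal_ne_top_iff_integrable hf hf0).1 (by simp [h]), ?_⟩
  rw [integral_eq_lintegral_of_nonneg_ae hf0 hf, h, ENNReal.toReal_ofReal hc]

/-- Convexity of Γ between 1 and 1 + k, together with k! ≥ 1 = Γ(1). Γ is not monotone on [1, 2], so
monotonicity alone would not do. -/
theorem Gamma_one_add_mul_nat_le {β : ℝ} (hβ0 : 0 ≤ β) (hβ1 : β ≤ 1) (k : ℕ) :
    Real.Gamma (1 + β * k) ≤ Real.Gamma (1 + k) := by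
  have hk : (0 : ℝ) < 1 + k := by positivity
  have h1 : 1 ≤ Real.Gamma (1 + k) := by
    rw [add_comm, Real.Gamma_nat_eq_factorial]
    exact_mod_cast Nat.one_le_iff_ne_zero.2 k.factorial_ne_zero
  have h := Real.convexOn_Gamma.2 (Set.mem_Ioi.2 one_pos) (Set.mem_Ioi.2 hk)
    (sub_nonneg.2 hβ1) hβ0 (sub_add_cancel 1 β)
  simp only [smul_eq_mul, Real.Gamma_one] at h
  rw [show (1 - β) * 1 + β * (1 + (k : ℝ)) = 1 + β * k by ring] at h
  nlinarith

/-- Change of variables for an a.s. positive random variable with a Lebesgue density. -/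
theorem IsLebesgueDensity.integral_comp_eq {Ω : Type*} [MeasurableSpace Ω] {μ : Measure Ω}
    {X : Ω → ℝ} {g : ℝ → ℝ} (hg : IsLebesgueDensity X μ g) (hX : Measurable X)
    (hX0 : ∀ᵐ ω ∂μ, 0 < X ω) {f : ℝ → ℝ} (hf : Measurable f) :
    ∫ ω, f (X ω) ∂μ = ∫ w in Set.Ioi (0 : ℝ), f w * g w := by
  -- The law lives on (0, ∞), so restricting it there changes nothing.
  have hpos : ∀ᵐ w ∂(μ.map X), w ∈ Set.Ioi (0 : ℝ) :=
    (ae_map_iff hX.aemeasurable measurableSet_Ioi).2 hX0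
  rw [← integral_map hX.aemeasurable hf.aestronglyMeasurable,
    ← Measure.restrict_eq_self_of_ae_mem hpos, hg.map_eq,
    restrict_withDensity measurableSet_Ioi,
    integral_withDensity_eq_integral_toReal_smul (by have := hg.measurable; fun_prop)
      (Filter.Eventually.of_forall fun _ => ENNReal.ofReal_lt_top)]
  refine integral_congr_ae (Filter.Eventually.of_forall fun w => ?_)
  simp only [ENNReal.toReal_ofReal (hg.nonneg w), smul_eq_mul, mul_comm]

theorem lemma2p3 {Ω : Type*} [MeasurableSpace Ω] (μ : Measure Ω) [IsProbabilityMeasure μ]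
    (β : ℝ) (hβ0 : 0 < β) (hβ1 : β < 1) (D : ℝ≥0 → Ω → ℝ) (hD : IsStableSubordinator β D μ)
    (d : ℕ) (hd : d = 1 ∨ d = 2 ∨ d = 3) (k : ℕ) (hk : 1 ≤ k) :
    (∀ᵐ ω ∂μ, 0 < D 1 ω) ∧
    Integrable (stablePower β D d k) μ ∧
    (∀ g : ℝ → ℝ, IsLebesgueDensity (D 1) μ g →
      stableMoment β D μ d k =
        ∫ w in Set.Ioi (0 : ℝ), w ^ (-(β * ((k : ℝ) - (d : ℝ) / 4))) * g w) ∧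
    0 < stableMoment β D μ d k ∧
    stableMoment β D μ d k ≤ 3 * (Real.Gamma (1 + (k : ℝ)) / Real.Gamma (1 + β * (k : ℝ))) := by
  have hX : Measurable (D 1) := hD.measurable 1
  have hL : ∀ s : ℝ, 0 ≤ s → ∫ ω, Real.exp (-(s * D 1 ω)) ∂μ = Real.exp (-(s ^ β)) := by
    intro s hs
    simpa using hD.laplace 1 s hs
  have hnonneg : ∀ᵐ ω ∂μ, 0 ≤ D 1 ω := by
    filter_upwards [hD.start_zero, hD.monotone_paths] with ω h0 hm
    rw [← h0]
    exact hm zero_le_one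
  have hX0 := ae_pos_of_laplace_eq_exp_neg_rpow hβ0 hX hnonneg hL
  have hmoment : ∀ x : ℝ, 0 < x → Integrable (fun ω => D 1 ω ^ (-(β * x))) μ ∧
      ∫ ω, D 1 ω ^ (-(β * x)) ∂μ = Real.Gamma (1 + x) / Real.Gamma (1 + β * x) := by
    intro x hx
    refine integrable_and_integral_eq_of_lintegral_ofReal_eq
      (hX.pow_const _).aestronglyMeasurable ?_ ?_
      (lintegral_rpow_neg_of_laplace_eq_exp_neg_rpow hβ0 hX hX0 hL hx)
    · filter_upwards [hX0] with ω hω using Real.rpow_nonneg hω.le _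
    · exact div_nonneg (Real.Gamma_pos_of_pos (by positivity)).le
        (Real.Gamma_pos_of_pos (by positivity)).le
  have hk1 : (1 : ℝ) ≤ k := by exact_mod_cast hk
  have hk0 : (0 : ℝ) < k := by linarith
  have hd3 : (d : ℝ) ≤ 3 := by
    rcases hd with rfl | rfl | rfl <;> norm_num
  have hd0 : (0 : ℝ) ≤ d := d.cast_nonneg
  have hx : 0 < (k : ℝ) - (d : ℝ) / 4 := by linarith
  have hxk : (k : ℝ) - (d : ℝ) / 4 ≤ k := by linarith
  refine ⟨hX0, (hmoment _ hx).1, fun g hg => ?_, ?_, ?_⟩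
  · exact hg.integral_comp_eq hX hX0
      (f := fun w => w ^ (-(β * ((k : ℝ) - (d : ℝ) / 4)))) (by fun_prop)
  · simp only [stableMoment, stablePower]
    rw [(hmoment _ hx).2]
    exact div_pos (Real.Gamma_pos_of_pos (by positivity)) (Real.Gamma_pos_of_pos (by positivity))
  · have hM : 1 ≤ Real.Gamma (1 + (k : ℝ)) / Real.Gamma (1 + β * (k : ℝ)) :=
      (one_le_div (Real.Gamma_pos_of_pos (by positivity))).2
        (Gamma_one_add_mul_nat_le hβ0.le hβ1.le k)
    obtain ⟨hik, hek⟩ := hmoment k hk0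
    set x := (k : ℝ) - (d : ℝ) / 4 with hxdef
    set M := Real.Gamma (1 + (k : ℝ)) / Real.Gamma (1 + β * (k : ℝ))
    have hθ0 : 0 ≤ x / k := by positivity
    have hθ1 : x / k ≤ 1 := (div_le_one hk0).2 hxk
    have hle : stableMoment β D μ d k ≤
        ∫ ω, ((1 - x / k) + x / k * D 1 ω ^ (-(β * k))) ∂μ := by
      refine integral_mono_ae (hmoment _ hx).1
        ((integrable_const _).add (hik.const_mul _)) ?_
      filter_upwards [hX0] with ω hω
      -- AM-GM for 1 and D_1^(-βk) with weights 1 - θ and θ = x/k.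
      have h := Real.geom_mean_le_arith_mean2_weighted (sub_nonneg.2 hθ1) hθ0 zero_le_one
        (Real.rpow_nonneg hω.le (-(β * k))) (sub_add_cancel 1 (x / k))
      rw [Real.one_rpow, one_mul, mul_one, ← Real.rpow_mul hω.le,
        show -(β * (k : ℝ)) * (x / k) = -(β * x) by field_simp] at h
      exact h
    rw [integral_add (integrable_const _) (hik.const_mul _), integral_const_mul, hek,
      integral_const, probReal_univ, one_smul] at hle
    -- (1 - θ) + θM ≤ M ≤ 3M, since M ≥ 1 and θ ≤ 1.
    nlinarith
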